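/- A polygonal curve in $\mathbb{R}^d$ with $k\ge 1$ vertices is a sequence of $k$ points of $\mathbb{R}^d$, i.e. a point of $\mathbb{R}^{dk}$. A coupling of two curves $P=(p_1,\dots,p_k)$ and $Q=(q_1,\dots,q_l)$ is a sequence of pairs of indices that starts with $(1,1)$, ends with $(k,l)$, and in which every pair $(i,j)$ is followed by one of $(i+1,j)$, $(i,j+1)$, $(i+1,j+1)$. The discrete Fréchet distance of $P$ and $Q$ is the minimum, over all couplings, of the maximal Euclidean distance $\|p_i-q_j\|$ over the pairs $(i,j)$ of the coupling. For a finite set $S$ of curves in $\mathbb{R}^d$ with $k$ vertices each, a Voronoi region of $S$ is a nonempty set consisting of all curves in $\mathbb{R}^d$ with $k$ vertices that have a given common set of nearest neighbours in $S$ under the discrete Fréchet distance. The combinatorial complexity of the Voronoi diagram of $S$ is measured by the number of Voronoi regions of $S$, i.e. the number of distinct nearest-neighbour sets. **Theorem.** Let $d,k\ge 1$ be integers with $(d,k)\ne(2,1)$. There is a constant $c>0$, depending only on $d$ and $k$, such that for every $n$ there is a set $S$ of $n$ polygonal curves in $\mathbb{R}^d$ with $k$ vertices each whose Voronoi diagram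 under the discrete Fréchet distance has combinatorial complexity at least $c\,n^{dk}$ if $d\in\{1,2\}$, and at least $c\,n^{d(k-1)+2}$ if $d>2$. That is, the complexity is $\Omega(n^{dk})$ for $d=1,2$ and $\Omega(n^{d(k-1)+2})$ for $d>2$, as a function of $n$. -/

import Mathlib

/-- A polygonal curve in `ℝ^d` with `k` vertices, given by its sequence of vertices
(a point of `ℝ^{dk}`). -/
abbrev PolygonalCurve (d k : ℕ) : Type := Fin k → EuclideanSpace ℝ (Fin d)

/-- One step of a coupling: in each of the two index components we stay or move on by one,
and we do not stay in both. -/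
def CouplingStep {k l : ℕ} (p q : Fin k × Fin l) : Prop :=
  p ≠ q ∧
  ((q.1 : ℕ) = p.1 ∨ (q.1 : ℕ) = p.1 + 1) ∧
  ((q.2 : ℕ) = p.2 ∨ (q.2 : ℕ) = p.2 + 1)

/-- A coupling of the vertex sequences of two curves with `k` and `l` vertices: a sequence of
pairs of indices that starts with the pair of first vertices, ends with the pair of last
vertices, and proceeds by coupling steps. -/
structure IsCoupling {k l : ℕ} (L : List (Fin k × Fin l)) : Prop where
  ne_nil : L ≠ []
  head : ∀ p ∈ L.head?, (p.1 : ℕ) = 0 ∧ (p.2 : ℕ) = 0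
  last : ∀ p ∈ L.getLast?, (p.1 : ℕ) + 1 = k ∧ (p.2 : ℕ) + 1 = l
  chain : L.IsChain CouplingStep

/-- The length of a coupling: the maximal Euclidean distance of two coupled vertices. -/
noncomputable def couplingLength {d k l : ℕ} (P : PolygonalCurve d k) (Q : PolygonalCurve d l)
    (L : List (Fin k × Fin l)) : ℝ :=
  (L.map fun p => dist (P p.1) (Q p.2)).foldr max 0

/-- The discrete Fréchet distance: the minimal length of a coupling. -/
noncomputable def discreteFrechetDist {d k l : ℕ} (P : PolygonalCurve d k)
    (Q : PolygonalCurve d l) : ℝ :=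
  sInf {r : ℝ | ∃ L : List (Fin k × Fin l), IsCoupling L ∧ r = couplingLength P Q L}

/-- The set of nearest neighbours of the curve `Q` among the curves in `S`, under the discrete
Fréchet distance. -/
def nearestNeighbors {d k : ℕ} (S : Finset (PolygonalCurve d k)) (Q : PolygonalCurve d k) :
    Set (PolygonalCurve d k) :=
  {P | P ∈ S ∧ ∀ P' ∈ S, discreteFrechetDist P Q ≤ discreteFrechetDist P' Q}

/-- The set of all curves with `k` vertices whose set of nearest neighbours in `S` is `T`. -/
def voronoiRegion {d k : ℕ} (S : Finset (PolygonalCurve d k)) (T : Set (PolygonalCurve d k)) :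
    Set (PolygonalCurve d k) :=
  {Q | nearestNeighbors S Q = T}

/-- The Voronoi diagram of `S` under the discrete Fréchet distance: the partition of the space of
curves with `k` vertices into the (nonempty) Voronoi regions, of all dimensions. -/
def voronoiDiagram {d k : ℕ} (S : Finset (PolygonalCurve d k)) :
    Set (Set (PolygonalCurve d k)) :=
  {R | R.Nonempty ∧ ∃ T : Set (PolygonalCurve d k), R = voronoiRegion S T}

/-- The combinatorial complexity of the Voronoi diagram: its number of Voronoi regions
(which is finite, as a region is determined by a subset of the finite set `S`). -/
noncomputable def voronoiComplexity {d k : ℕ} (S : Finset (PolygonalCurve d k)) : ℕ :=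
  (voronoiDiagram S).ncard

open Set

/-! Add to every curve a fixed curve whose vertices are very far apart. For the resulting curves the
Fréchet distance is the supremum over `j` of the distances of the `j`-th vertices
(`discreteFrechetDist_spreadCurve_add`), so it suffices to find `O(m)` sites and `m ^ D` queries
whose nearest sets in the supremum metric are pairwise different. For at least two vertices
(`exists_injective_nearest`), the first vertex of a query fixes the nearest distance `r` and selects
one of the points `b i`. Each other vertex `y` is a small vector; its ball of radius `r` cuts every
half-axis at about `r ± y c`, and sites placed along the half-axes record these cuts. Opposite
half-axes give `r` and `y c` separately, so `i`, `r` and all coordinates of the later vertices vary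
independently. In dimension at least two, `m` points on a circle serve as the `b i`; on the line
there is a single one, which costs one factor `m`. For one vertex, the line is elementary, and in
dimension at least three a circle and its axis give the quadratic bound
(`exists_injective_nearest_point`). -/

/-! ### Couplings and bounds for the discrete Fréchet distance -/

/-- Discrete intermediate values: the first index runs from the first to the last vertex in steps of
at most one. -/
theorem IsCoupling.exists_mem_fst {k l : ℕ} {L : List (Fin k × Fin l)} (hL : IsCoupling L)
    (i : Fin k) : ∃ j, (i, j) ∈ L := by
  have key : ∀ (L : List (Fin k × Fin l)), L.IsChain CouplingStep →
      (∀ p ∈ L.head?, (p.1 : ℕ) ≤ i) → (∀ p ∈ L.getLast?, (i : ℕ) ≤ p.1) → L ≠ [] →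
      ∃ j, (i, j) ∈ L := by
    intro L
    induction L with
    | nil => intro _ _ _ h; exact absurd rfl h
    | cons p L ih =>
      intro hc hh hl _
      have hp : (p.1 : ℕ) ≤ i := hh p (by simp)
      rcases hp.eq_or_lt with h | h
      · exact ⟨p.2, by simp [← Fin.ext h]⟩
      · cases L with
        | nil =>
          have := hl p (by simp)
          omega
        | cons q L =>
          rw [List.isChain_cons_cons] at hc
          obtain ⟨j, hj⟩ := ih hc.2 (by
            intro q' hq'
            simp only [List.head?_cons, Option.mem_def, Option.some.injEq] at hq'
            subst hq'
            rcases hc.1.2.1 with h' | h' <;> omega) (by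
            intro q' hq'
            exact hl q' (by simpa [List.getLast?_cons_cons] using hq')) (by simp)
          exact ⟨j, List.mem_cons_of_mem _ hj⟩
  refine key L hL.chain (fun p hp => ?_) (fun p hp => ?_) hL.ne_nil
  · rw [(hL.head p hp).1]; omega
  · have := (hL.last p hp).1
    omega

theorem IsCoupling.zero_mem {k l : ℕ} {L : List (Fin (k + 1) × Fin (l + 1))}
    (hL : IsCoupling L) : (0, 0) ∈ L := by
  cases L with
  | nil => exact absurd rfl hL.ne_nil
  | cons p L =>
    have h := hL.head p (by simp)
    have : p = (0, 0) := Prod.ext (Fin.ext h.1) (Fin.ext h.2)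
    simp [this]

theorem isCoupling_diagonal (k : ℕ) :
    IsCoupling ((List.finRange (k + 1)).map fun i => (i, i)) where
  ne_nil := by simp [List.finRange_succ]
  head := by simp [List.finRange_succ]
  last := by simp [List.finRange_succ_last]
  chain := by
    rw [List.isChain_iff_getElem]
    intro i hi
    simp [CouplingStep, Fin.ext_iff]

section

variable {d k l : ℕ}

theorem couplingLength_le {P : PolygonalCurve d k} {Q : PolygonalCurve d l}
    {L : List (Fin k × Fin l)} {r : ℝ} (hr : 0 ≤ r) (h : ∀ p ∈ L, dist (P p.1) (Q p.2) ≤ r) :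
    couplingLength P Q L ≤ r := by
  induction L with
  | nil => simpa [couplingLength] using hr
  | cons p L ih =>
    simp only [couplingLength, List.map_cons, List.foldr_cons] at ih ⊢
    exact max_le (h p (by simp)) (ih fun q hq => h q (List.mem_cons_of_mem _ hq))

theorem dist_le_couplingLength {P : PolygonalCurve d k} {Q : PolygonalCurve d l}
    {L : List (Fin k × Fin l)} {p : Fin k × Fin l} (hp : p ∈ L) :
    dist (P p.1) (Q p.2) ≤ couplingLength P Q L := by
  induction L with
  | nil => simp at hp
  | cons q L ih =>
    simp only [couplingLength, List.map_cons, List.foldr_cons] at ih ⊢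
    rcases List.mem_cons.1 hp with rfl | h
    · exact le_max_left _ _
    · exact (ih h).trans (le_max_right _ _)

theorem discreteFrechetDist_le_dist (P Q : PolygonalCurve d (k + 1)) :
    discreteFrechetDist P Q ≤ dist P Q := by
  have h : couplingLength P Q ((List.finRange (k + 1)).map fun i => (i, i)) ≤ dist P Q := by
    refine couplingLength_le dist_nonneg fun p hp => ?_
    obtain ⟨i, -, rfl⟩ := List.mem_map.1 hp
    exact dist_le_pi_dist P Q i
  refine le_trans (csInf_le ?_ ?_) h
  · refine ⟨0, ?_⟩
    rintro _ ⟨L, hL, rfl⟩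
    exact dist_nonneg.trans (dist_le_couplingLength hL.zero_mem)
  · exact ⟨_, isCoupling_diagonal k, rfl⟩

theorem le_discreteFrechetDist {P Q : PolygonalCurve d (k + 1)} {r : ℝ}
    (h : ∀ L, IsCoupling L → r ≤ couplingLength P Q L) : r ≤ discreteFrechetDist P Q := by
  refine le_csInf ⟨_, _, isCoupling_diagonal k, rfl⟩ ?_
  rintro _ ⟨L, hL, rfl⟩
  exact h L hL

theorem dist_zero_le_discreteFrechetDist (P Q : PolygonalCurve d (k + 1)) :
    dist (P 0) (Q 0) ≤ discreteFrechetDist P Q :=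
  le_discreteFrechetDist fun _ hL => dist_le_couplingLength (p := (0, 0)) hL.zero_mem

/-- If different vertices of the two curves are far apart, then the discrete Fréchet distance is
the supremum distance of the curves. -/
theorem discreteFrechetDist_eq_dist {P Q : PolygonalCurve d (k + 1)}
    (h : ∀ i j, i ≠ j → dist P Q ≤ dist (P i) (Q j)) : discreteFrechetDist P Q = dist P Q := by
  refine le_antisymm (discreteFrechetDist_le_dist P Q) (le_discreteFrechetDist fun L hL => ?_)
  refine (dist_pi_le_iff (dist_nonneg.trans (dist_le_couplingLength hL.zero_mem))).2 fun i => ?_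
  obtain ⟨j, hj⟩ := hL.exists_mem_fst i
  refine le_trans ?_ (dist_le_couplingLength hj)
  by_cases hij : i = j
  · simp [hij]
  · exact (dist_le_pi_dist P Q i).trans (h i j hij)

/-! ### Counting Voronoi regions by query curves -/

theorem finite_voronoiDiagram (S : Finset (PolygonalCurve d k)) : (voronoiDiagram S).Finite := by
  refine ((S.finite_toSet.finite_subsets).image (voronoiRegion S)).subset ?_
  rintro R ⟨⟨Q, hQ⟩, T, rfl⟩
  refine ⟨T, ?_, rfl⟩
  have hQ : nearestNeighbors S Q = T := hQ
  rw [← hQ]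
  exact fun P hP => hP.1

theorem card_le_voronoiComplexity {α : Type*} [Fintype α] (S : Finset (PolygonalCurve d k))
    (Q : α → PolygonalCurve d k) (hQ : Function.Injective fun a => nearestNeighbors S (Q a)) :
    Fintype.card α ≤ voronoiComplexity S := by
  have hinj : Function.Injective fun a => voronoiRegion S (nearestNeighbors S (Q a)) := by
    intro a b hab
    have hmem : Q a ∈ voronoiRegion S (nearestNeighbors S (Q a)) := rfl
    have hab : voronoiRegion S (nearestNeighbors S (Q a)) =
      voronoiRegion S (nearestNeighbors S (Q b)) := hab
    rw [hab] at hmem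
    exact hQ hmem
  rw [← Nat.card_eq_fintype_card, ← Nat.card_range_of_injective hinj]
  -- Finiteness is essential, as `ncard` of an infinite set is 0.
  refine Set.ncard_le_ncard ?_ (finite_voronoiDiagram S)
  rintro _ ⟨a, rfl⟩
  exact ⟨⟨Q a, rfl⟩, _, rfl⟩

end

/-! ### Reduction to the supremum metric -/

/-- The vertex `j` of the curve is the point `(L * j, 0, …, 0)`. -/
noncomputable def spreadCurve (d k : ℕ) (L : ℝ) : PolygonalCurve (d + 1) k :=
  fun j => EuclideanSpace.single 0 (L * (j : ℕ))

theorem le_dist_spreadCurve {d k : ℕ} {L : ℝ} (hL : 0 ≤ L) {i j : Fin k} (hij : i ≠ j) :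
    L ≤ dist (spreadCurve d k L i) (spreadCurve d k L j) := by
  rw [spreadCurve, spreadCurve, PiLp.dist_single_same, Real.dist_eq, ← mul_sub, abs_mul,
    abs_of_nonneg hL]
  refine le_mul_of_one_le_right hL ?_
  have h : ((i : ℕ) : ℤ) - ((j : ℕ) : ℤ) ≠ 0 := by
    intro h
    exact hij (Fin.ext (by omega))
  exact_mod_cast Int.one_le_abs h

/-- Vertices with different indices stay at distance at least `4R - 2R`, and `2R` bounds `dist p q`.
-/
theorem discreteFrechetDist_spreadCurve_add {d k : ℕ} {R : ℝ} (hR : 0 ≤ R)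
    {p q : PolygonalCurve (d + 1) (k + 1)} (hp : ‖p‖ ≤ R) (hq : ‖q‖ ≤ R) :
    discreteFrechetDist (spreadCurve d (k + 1) (4 * R) + p) (spreadCurve d (k + 1) (4 * R) + q) =
      dist p q := by
  rw [discreteFrechetDist_eq_dist, dist_add_left]
  intro i j hij
  rw [dist_add_left, Pi.add_apply, Pi.add_apply]
  have h1 := le_dist_spreadCurve (d := d) (mul_nonneg zero_le_four hR) hij
  set c := spreadCurve d (k + 1) (4 * R)
  have h2 : dist p q ≤ 2 * R := (dist_le_norm_add_norm p q).trans (by linarith)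
  have h3 : dist (c i) (c j) ≤ dist (c i) (c i + p i) + dist (c i + p i) (c j + q j) +
    dist (c j + q j) (c j) := dist_triangle4 _ _ _ _
  have h4 : dist (c i) (c i + p i) ≤ R := by
    rw [dist_self_add_right]; exact (norm_le_pi_norm p i).trans hp
  have h5 : dist (c j + q j) (c j) ≤ R := by
    rw [dist_self_add_left]; exact (norm_le_pi_norm q j).trans hq
  linarith

/-- Supplies remote curves that pad a set of sites to exactly `n` elements. -/
theorem infinite_lt_norm_apply_zero (d k : ℕ) (R : ℝ) :
    {P : PolygonalCurve (d + 1) (k + 1) | R < ‖P 0‖}.Infinite := by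
  refine Set.infinite_of_injective_forall_mem
    (f := fun n : ℕ => fun _ => EuclideanSpace.single 0 (|R| + 1 + n)) ?_ ?_
  · intro m n h
    have := congrArg (fun P : PolygonalCurve (d + 1) (k + 1) => P 0 0) h
    simpa using this
  · intro n
    have h : (0 : ℝ) ≤ |R| + 1 + n := by positivity
    simp only [mem_ofPred_eq, PiLp.norm_single, Real.norm_eq_abs, abs_of_nonneg h]
    have := le_abs_self R
    have : (0 : ℝ) ≤ n := Nat.cast_nonneg n
    linarith

/-- Sites `f i` and query curves `Q a` whose nearest sites in the supremum distance are pairwise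
different give rise to a Voronoi diagram with many regions. -/
theorem exists_card_le_voronoiComplexity {d k : ℕ} {I α : Type*} [Fintype I]
    [Fintype α] (f : I → PolygonalCurve (d + 1) (k + 1)) (Q : α → PolygonalCurve (d + 1) (k + 1))
    (hQ : Function.Injective fun a => {i | ∀ i', dist (f i) (Q a) ≤ dist (f i') (Q a)})
    {n : ℕ} (hn : Fintype.card I ≤ n) :
    ∃ S : Finset (PolygonalCurve (d + 1) (k + 1)),
      S.card = n ∧ Fintype.card α ≤ voronoiComplexity S := by
  classical
  obtain ⟨R, hR0, hf, hq⟩ : ∃ R : ℝ, 0 ≤ R ∧ (∀ i, ‖f i‖ ≤ R) ∧ ∀ a, ‖Q a‖ ≤ R := by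
    refine ⟨∑ i, ‖f i‖ + ∑ a, ‖Q a‖, by positivity, fun i => ?_, fun a => ?_⟩
    · have := Finset.single_le_sum (f := fun i => ‖f i‖) (fun i _ => norm_nonneg _)
        (Finset.mem_univ i)
      have : 0 ≤ ∑ a, ‖Q a‖ := by positivity
      linarith
    · have := Finset.single_le_sum (f := fun a => ‖Q a‖) (fun i _ => norm_nonneg _)
        (Finset.mem_univ a)
      have : 0 ≤ ∑ i, ‖f i‖ := by positivity
      linarith
  set c := spreadCurve d (k + 1) (4 * R) with hc
  have hc0 : c 0 = 0 := by simp [hc, spreadCurve]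
  set S₀ := Finset.univ.image fun i => c + f i with hS₀
  have hcard : S₀.card ≤ n := Finset.card_image_le.trans hn
  obtain ⟨F, hF, hFcard⟩ :=
    (infinite_lt_norm_apply_zero d k (3 * R)).exists_subset_card_eq (n - S₀.card)
  have hdisj : Disjoint S₀ F := by
    rw [Finset.disjoint_left]
    intro P hP hPF
    obtain ⟨i, -, rfl⟩ := Finset.mem_image.1 hP
    have h1 : 3 * R < ‖(c + f i) 0‖ := hF hPF
    rw [Pi.add_apply, hc0, zero_add] at h1
    have := (norm_le_pi_norm (f i) 0).trans (hf i)
    linarith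
  refine ⟨S₀ ∪ F, by rw [Finset.card_union_of_disjoint hdisj, hFcard]; omega,
    card_le_voronoiComplexity _ (fun a => c + Q a) ?_⟩
  have key : ∀ a i, c + f i ∈ nearestNeighbors (S₀ ∪ F) (c + Q a) ↔
      ∀ i', dist (f i) (Q a) ≤ dist (f i') (Q a) := by
    intro a i
    have hmem : ∀ i, c + f i ∈ S₀ := fun i => Finset.mem_image_of_mem _ (Finset.mem_univ i)
    constructor
    · intro h i'
      have := h.2 (c + f i') (Finset.mem_union_left _ (hmem i'))
      rwa [discreteFrechetDist_spreadCurve_add hR0 (hf _) (hq _),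
        discreteFrechetDist_spreadCurve_add hR0 (hf _) (hq _)] at this
    · intro h
      refine ⟨Finset.mem_union_left _ (hmem i), fun P hP => ?_⟩
      rw [discreteFrechetDist_spreadCurve_add hR0 (hf _) (hq _)]
      rcases Finset.mem_union.1 hP with hP | hP
      · obtain ⟨i', -, rfl⟩ := Finset.mem_image.1 hP
        rw [discreteFrechetDist_spreadCurve_add hR0 (hf _) (hq _)]
        exact h i'
      -- A padding curve is never nearest: its first vertex is more than `3R - R` from that of the
      -- query, while the sites `c + f i` are within `2R`.
      · refine le_trans ?_ (dist_zero_le_discreteFrechetDist _ _)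
        have h1 : 3 * R < ‖P 0‖ := hF hP
        rw [Pi.add_apply, hc0, zero_add, dist_eq_norm (P 0)]
        have h2 := norm_sub_norm_le (P 0) (Q a 0)
        have h3 := (norm_le_pi_norm (Q a) 0).trans (hq a)
        have h4 := dist_le_norm_add_norm (f i) (Q a)
        linarith [hf i, hq a]
  intro a b hab
  refine hQ (Set.ext fun i => ?_)
  have hab : nearestNeighbors (S₀ ∪ F) (c + Q a) = nearestNeighbors (S₀ ∪ F) (c + Q b) := hab
  rw [mem_ofPred_eq, mem_ofPred_eq, ← key, ← key, hab]

/-- For `n ≥ N` take `m = n / N`, which loses at most a factor 2 in rounding. For `n < N` the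
constant makes the bound at most 1, and one region always exists. -/
theorem exists_pow_le_voronoiComplexity {d k : ℕ} (D N : ℕ) (hN : 0 < N)
    (h : ∀ m : ℕ, 1 ≤ m → ∃ (I α : Type) (_ : Fintype I) (_ : Fintype α)
      (f : I → PolygonalCurve (d + 1) (k + 1)) (Q : α → PolygonalCurve (d + 1) (k + 1)),
      Fintype.card I ≤ N * m ∧ m ^ D ≤ Fintype.card α ∧
      Function.Injective fun a => {i | ∀ i', dist (f i) (Q a) ≤ dist (f i') (Q a)}) :
    ∃ c : ℝ, 0 < c ∧ ∀ n : ℕ, ∃ S : Finset (PolygonalCurve (d + 1) (k + 1)),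
      S.card = n ∧ c * (n : ℝ) ^ D ≤ (voronoiComplexity S : ℝ) := by
  have hN' : (0 : ℝ) < N := by exact_mod_cast hN
  refine ⟨(1 / (2 * N)) ^ D, by positivity, fun n => ?_⟩
  rw [← mul_pow]
  rcases lt_or_ge n N with hn | hn
  · obtain ⟨S, -, hS⟩ := (infinite_lt_norm_apply_zero d k 0).exists_subset_card_eq n
    refine ⟨S, hS, ?_⟩
    have h1 : 1 ≤ voronoiComplexity S := by
      simpa using card_le_voronoiComplexity S (fun _ : Unit => 0)
        (Function.injective_of_subsingleton _)
    refine le_trans (pow_le_one₀ (by positivity) ?_) (by exact_mod_cast h1 : (1 : ℝ) ≤ _)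
    have : (n : ℝ) ≤ N := by exact_mod_cast hn.le
    rw [one_div_mul_eq_div, div_le_one (by positivity)]
    linarith
  · obtain ⟨I, α, _, _, f, Q, hI, hα, hQ⟩ := h (n / N) (Nat.div_pos hn hN)
    obtain ⟨S, hS, hcomp⟩ := exists_card_le_voronoiComplexity f Q hQ
      (hI.trans (Nat.mul_div_le n N))
    refine ⟨S, hS, ?_⟩
    refine le_trans ?_ (by exact_mod_cast hα.trans hcomp :
      (((n / N : ℕ) : ℝ)) ^ D ≤ (voronoiComplexity S : ℝ))
    refine pow_le_pow_left₀ (by positivity) ?_ D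
    have h1 : n < 2 * N * (n / N) := by
      have h2 := Nat.lt_mul_div_succ n hN
      have h3 : 1 ≤ n / N := Nat.div_pos hn hN
      nlinarith
    rw [one_div_mul_eq_div, div_le_iff₀ (by positivity)]
    have : (n : ℝ) ≤ 2 * N * (n / N : ℕ) := by exact_mod_cast h1.le
    linarith

theorem setOf_forall_dist_le_eq {X I : Type*} [PseudoMetricSpace X] {f : I → X} {q : X} {r : ℝ}
    (h : ∀ i, r ≤ dist (f i) q) (i₀ : I) (h₀ : dist (f i₀) q ≤ r) :
    {i | ∀ i', dist (f i) q ≤ dist (f i') q} = {i | dist (f i) q ≤ r} :=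
  Set.ext fun _ => ⟨fun hi => (hi i₀).trans h₀, fun hi i' => le_trans hi (h i')⟩

/-! ### Balls cutting the half-axes, and the main construction -/

section Cut

variable {d : ℕ}

theorem dist_single_sq (c : Fin d) (t : ℝ) (y : EuclideanSpace ℝ (Fin d)) :
    dist (EuclideanSpace.single c t) y ^ 2 = (t - y c) ^ 2 + (‖y‖ ^ 2 - y c ^ 2) := by
  rw [dist_eq_norm, norm_sub_sq_real, EuclideanSpace.inner_single_left, PiLp.norm_single]
  simp
  ring

theorem apply_sq_le_norm_sq (y : EuclideanSpace ℝ (Fin d)) (c : Fin d) :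
    y c ^ 2 ≤ ‖y‖ ^ 2 := by
  rw [← sq_abs]
  exact pow_le_pow_left₀ (abs_nonneg _) (PiLp.norm_apply_le y c) 2

/-- A ball around `y` of radius `1 + δ M` contains an initial segment of a sequence of points on
a coordinate ray, the length of which is determined by the coordinate of `y` and by `M`. -/
theorem dist_single_le_iff (c : Fin d) (y : EuclideanSpace ℝ (Fin d)) (σ : ℤˣ) {δ : ℝ}
    (hδ : 0 < δ) (hδ1 : δ ≤ 1) (hy : ‖y‖ ^ 2 ≤ δ / 2) {i M a : ℕ} (hi : y c = δ * i) :
    dist (EuclideanSpace.single c ((σ : ℤ) * (1 + δ * (a + 1 / 2)) : ℝ)) y ≤ 1 + δ * M ↔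
      (a : ℤ) < M + σ * i := by
  have hσ : (((σ : ℤ) : ℝ)) ^ 2 = 1 := by
    rcases Int.units_eq_one_or σ with rfl | rfl <;> simp
  have hr : 0 ≤ 1 + δ * M := by positivity
  have hyc := apply_sq_le_norm_sq y c
  rw [← pow_le_pow_iff_left₀ dist_nonneg hr two_ne_zero, dist_single_sq]
  have hsq : ((σ : ℤ) * (1 + δ * (a + 1 / 2)) - y c : ℝ) ^ 2 =
      (1 + δ * (a + 1 / 2) - (σ : ℤ) * (δ * i)) ^ 2 := by
    rw [hi]
    linear_combination ((1 + δ * (a + 1 / 2)) ^ 2 - (δ * i) ^ 2) * hσ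
  have habs : ((σ : ℤ) * (δ * i) : ℝ) ^ 2 = y c ^ 2 := by
    rw [mul_pow, hσ, hi, one_mul]
  rw [hsq]
  constructor
  · intro h
    by_contra! hlt
    have hlt' : (M + (σ : ℤ) * i : ℝ) ≤ a := by exact_mod_cast hlt
    have h1 : 1 + δ * M < 1 + δ * (a + 1 / 2) - (σ : ℤ) * (δ * i) := by
      nlinarith [mul_le_mul_of_nonneg_left hlt' hδ.le]
    have := pow_lt_pow_left₀ h1 hr two_ne_zero
    linarith
  · intro h
    have h' : (a + 1 : ℝ) ≤ M + (σ : ℤ) * i := by exact_mod_cast h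
    have h1 : 1 + δ * (a + 1 / 2) - (σ : ℤ) * (δ * i) ≤ 1 + δ * M - δ / 2 := by
      nlinarith [mul_le_mul_of_nonneg_left h' hδ.le]
    have h2 : 0 ≤ 1 + δ * (a + 1 / 2) - (σ : ℤ) * (δ * i) := by
      have h3 : ((σ : ℤ) * (δ * i) : ℝ) ≤ 1 := by
        refine le_of_sq_le_sq ?_ zero_le_one
        rw [habs]; linarith
      have : 0 ≤ δ * (a + 1 / 2) := by positivity
      linarith
    -- The offset `1 / 2` leaves slack `δ / 2` in the radius, hence at least `δ / 2` in its square.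
    -- This absorbs the part of `y` orthogonal to the axis.
    have h3 := pow_le_pow_left₀ h2 h1 2
    have h4 : 0 ≤ δ * (δ * M) := by positivity
    nlinarith [sq_nonneg (y c)]

end Cut

theorem dist_finCons_le_iff {X : Type*} [PseudoMetricSpace X] {k : ℕ} {x y : X} {p q : Fin k → X}
    {r : ℝ} (hr : 0 ≤ r) :
    dist (Fin.cons x p : Fin (k + 1) → X) (Fin.cons y q) ≤ r ↔
      dist x y ≤ r ∧ ∀ j, dist (p j) (q j) ≤ r := by
  simp [dist_pi_le_iff hr, Fin.forall_fin_succ]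

theorem eq_of_forall_lt_iff_lt {B : ℕ} {x y : ℤ} (hx0 : 0 ≤ x) (hxB : x ≤ B) (hy0 : 0 ≤ y)
    (hyB : y ≤ B) (h : ∀ a : Fin B, ((a : ℕ) : ℤ) < x ↔ ((a : ℕ) : ℤ) < y) : x = y := by
  rcases lt_trichotomy x y with hlt | rfl | hlt
  · have := h ⟨x.toNat, by omega⟩
    simp only [Int.toNat_of_nonneg hx0] at this
    omega
  · rfl
  · have := h ⟨y.toNat, by omega⟩
    simp only [Int.toNat_of_nonneg hy0] at this
    omega

/-- The sites are curves that differ from a constant curve in one vertex only: either in the first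
one, which is then one of the points `b i`, or in another one, which is then on a coordinate axis.
The first vertex of a query curve selects a point `b i`, and its other vertices, together with the
distance to the nearest sites, select an initial segment on each of the half-axes. -/
theorem exists_injective_nearest {d k m : ℕ} (hm : 1 ≤ m) {ι : Type*}
    (b : ι → EuclideanSpace ℝ (Fin (d + 1))) {ε : ℝ} (hε : 0 < ε)
    (hb : ∀ r, 1 ≤ r → r ≤ 1 + ε → ∀ i, ∃ q, ‖q‖ = r ∧ dist (b i) q = r ∧
      ∀ i', i' ≠ i → r < dist (b i') q) :
    ∃ (f : ι ⊕ (Fin (k + 1) × Fin (d + 1) × ℤˣ × Fin (3 * m)) → PolygonalCurve (d + 1) (k + 2))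
      (Q : ι × Fin m × (Fin (k + 1) → Fin (d + 1) → Fin m) → PolygonalCurve (d + 1) (k + 2)),
      Function.Injective fun a => {i | ∀ i', dist (f i) (Q a) ≤ dist (f i') (Q a)} := by
  -- The third bound on `δ` keeps all radii below `1 + ε`; the fourth gives `‖y‖ ^ 2 ≤ (d + 1) (δ m)
  -- ^ 2 ≤ δ / 2`.
  have hm0 : (0 : ℝ) < m := by exact_mod_cast hm
  obtain ⟨δ, hδ, hδ1, hδε, hδm⟩ : ∃ δ : ℝ, 0 < δ ∧ δ ≤ 1 ∧ δ * (2 * m) ≤ ε ∧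
      δ * (2 * (d + 1) * m ^ 2) ≤ 1 := by
    refine ⟨min 1 (min (ε / (2 * m)) (1 / (2 * (d + 1) * m ^ 2))), by positivity,
      min_le_left _ _, ?_, ?_⟩
    · rw [← le_div_iff₀ (by positivity)]
      exact (min_le_right _ _).trans (min_le_left _ _)
    · rw [← le_div_iff₀ (by positivity)]
      exact (min_le_right _ _).trans (min_le_right _ _)
  -- The shift by `m` keeps all cut positions `m + l ± g j c` between 0 and `3 * m`.
  set r : Fin m → ℝ := fun l => 1 + δ * (m + l : ℕ) with hr
  have hr1 : ∀ l, 1 ≤ r l := fun l => le_add_of_nonneg_right (by positivity)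
  have hr0 : ∀ l, 0 ≤ r l := fun l => zero_le_one.trans (hr1 l)
  have hrε : ∀ l, r l ≤ 1 + ε := by
    intro l
    have h1 : ((m + l : ℕ) : ℝ) ≤ 2 * m := by
      have : m + (l : ℕ) ≤ 2 * m := by omega
      exact_mod_cast this
    have := mul_le_mul_of_nonneg_left h1 hδ.le
    simp only [hr]
    linarith
  choose q hq1 hq2 hq3 using fun l => hb (r l) (hr1 l) (hrε l)
  set y : (Fin (k + 1) → Fin (d + 1) → Fin m) → Fin (k + 1) → EuclideanSpace ℝ (Fin (d + 1)) :=
    fun g j => WithLp.toLp 2 fun c => δ * (g j c : ℕ) with hy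
  have hynorm : ∀ g j, ‖y g j‖ ^ 2 ≤ δ / 2 := by
    intro g j
    rw [EuclideanSpace.norm_sq_eq]
    have h1 : ∀ c ∈ Finset.univ, ‖y g j c‖ ^ 2 ≤ δ ^ 2 * (m : ℝ) ^ 2 := by
      intro c _
      have h2 : ((g j c : ℕ) : ℝ) ≤ m := by exact_mod_cast (g j c).2.le
      rw [Real.norm_eq_abs, sq_abs, ← mul_pow]
      exact pow_le_pow_left₀ (by positivity) (mul_le_mul_of_nonneg_left h2 hδ.le) 2
    refine (Finset.sum_le_card_nsmul _ _ _ h1).trans ?_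
    rw [Finset.card_univ, Fintype.card_fin, nsmul_eq_mul]
    push_cast
    nlinarith [mul_le_mul_of_nonneg_left hδm hδ.le]
  have hynorm1 : ∀ g j, ‖y g j‖ ≤ 1 := by
    intro g j
    refine le_of_sq_le_sq ?_ zero_le_one
    linarith [hynorm g j]
  set s : Fin (k + 1) × Fin (d + 1) × ℤˣ × Fin (3 * m) →
      Fin (k + 1) → EuclideanSpace ℝ (Fin (d + 1)) := fun x =>
    Pi.single x.1 (EuclideanSpace.single x.2.1
      (((x.2.2.1 : ℤ) : ℝ) * (1 + δ * ((x.2.2.2 : ℕ) + 1 / 2)))) with hs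
  refine ⟨Sum.elim (fun i => Fin.cons (b i) 0) (fun x => Fin.cons 0 (s x)),
    fun x => Fin.cons (q x.2.1 x.1) (y x.2.2), ?_⟩
  set f : ι ⊕ (Fin (k + 1) × Fin (d + 1) × ℤˣ × Fin (3 * m)) → PolygonalCurve (d + 1) (k + 2) :=
    Sum.elim (fun i => Fin.cons (b i) 0) (fun x => Fin.cons 0 (s x)) with hf
  set Q : ι × Fin m × (Fin (k + 1) → Fin (d + 1) → Fin m) → PolygonalCurve (d + 1) (k + 2) :=
    fun x => Fin.cons (q x.2.1 x.1) (y x.2.2) with hQ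
  have hinl : ∀ i l g i', dist (f (Sum.inl i')) (Q (i, l, g)) ≤ r l ↔ i' = i := by
    intro i l g i'
    simp only [hf, hQ, Sum.elim_inl]
    rw [dist_finCons_le_iff (hr0 l)]
    constructor
    · rintro ⟨h, -⟩
      by_contra hne
      exact absurd h (not_le.2 (hq3 l i i' hne))
    · rintro rfl
      refine ⟨(hq2 l i').le, fun j => ?_⟩
      rw [Pi.zero_apply, dist_zero_left]
      exact (hynorm1 g j).trans (hr1 l)
  have hinr : ∀ i l g j c σ a, dist (f (Sum.inr (j, c, σ, a))) (Q (i, l, g)) ≤ r l ↔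
      ((a : ℕ) : ℤ) < (m + l : ℕ) + (σ : ℤ) * (g j c : ℕ) := by
    intro i l g j c σ a
    simp only [hf, hQ, Sum.elim_inr]
    rw [dist_finCons_le_iff (hr0 l), ← dist_single_le_iff c (y g j) σ hδ hδ1 (hynorm g j) rfl]
    constructor
    · rintro ⟨-, h⟩
      simpa [hs, hr] using h j
    · intro h
      refine ⟨by rw [dist_zero_left, hq1], fun j' => ?_⟩
      rcases eq_or_ne j' j with rfl | hne
      · simpa [hs, hr] using h
      · simp only [hs, Pi.single_eq_of_ne hne, dist_zero_left]
        exact (hynorm1 g j').trans (hr1 l)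
  -- The first vertex of every site is 0 or some `b i'`, none of which is closer than `r` to `q`; so
  -- the nearest distance is exactly `r`.
  have hlow : ∀ x i, r x.2.1 ≤ dist (f i) (Q x) := by
    rintro ⟨i, l, g⟩ i'
    refine le_trans ?_ (dist_le_pi_dist (f i') (Q (i, l, g)) 0)
    rcases i' with i' | x
    · simp only [hf, hQ, Sum.elim_inl, Fin.cons_zero]
      rcases eq_or_ne i' i with rfl | hne
      · exact (hq2 l i').ge
      · exact (hq3 l i i' hne).le
    · simp only [hf, hQ, Sum.elim_inr, Fin.cons_zero]
      rw [dist_zero_left, hq1]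
  have hset : ∀ x, {i | ∀ i', dist (f i) (Q x) ≤ dist (f i') (Q x)} =
      {i | dist (f i) (Q x) ≤ r x.2.1} := fun x =>
    setOf_forall_dist_le_eq (hlow x) (Sum.inl x.1) ((hinl x.1 x.2.1 x.2.2 x.1).2 rfl)
  rintro ⟨i, l, g⟩ ⟨i', l', g'⟩ h
  simp only [hset] at h
  have h' : ∀ z, dist (f z) (Q (i, l, g)) ≤ r l ↔ dist (f z) (Q (i', l', g')) ≤ r l' :=
    fun z => Set.ext_iff.1 h z
  have hi : i = i' := (hinl i' l' g' i).1 ((h' _).1 ((hinl i l g i).2 rfl))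
  have hcut : ∀ j c (σ : ℤˣ), ((m + l : ℕ) : ℤ) + (σ : ℤ) * (g j c : ℕ) =
      (m + l' : ℕ) + (σ : ℤ) * (g' j c : ℕ) := by
    intro j c σ
    have hg := (g j c).2
    have hg' := (g' j c).2
    have hl := l.2
    have hl' := l'.2
    refine eq_of_forall_lt_iff_lt (B := 3 * m) ?_ ?_ ?_ ?_ (fun a => by
      rw [← hinr i l g, ← hinr i' l' g', h']) <;>
    rcases Int.units_eq_one_or σ with rfl | rfl <;> push_cast <;> omega
  -- Adding the cuts on opposite half-axes recovers `l`; subtracting them recovers `g j c`.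
  have hpm : ∀ j c, (l : ℕ) = l' ∧ (g j c : ℕ) = g' j c := by
    intro j c
    have h1 := hcut j c 1
    have h2 := hcut j c (-1)
    push_cast at h1 h2
    omega
  have hl : l = l' := Fin.ext (hpm 0 0).1
  have hg : g = g' := funext fun j => funext fun c => Fin.ext (hpm j c).2
  rw [hi, hl, hg]

/-! ### Points on a circle -/

section Circle

variable {d : ℕ}

/-- The point with angle `θ` on the unit circle in the plane of the first two coordinates. -/
noncomputable def circlePoint (d : ℕ) (θ : ℝ) : EuclideanSpace ℝ (Fin (d + 2)) :=
  EuclideanSpace.single 0 (Real.cos θ) + EuclideanSpace.single 1 (Real.sin θ)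

theorem inner_circlePoint (θ φ : ℝ) :
    inner ℝ (circlePoint d θ) (circlePoint d φ) = Real.cos (θ - φ) := by
  simp [circlePoint, inner_add_left, EuclideanSpace.inner_single_left, Real.cos_sub]

theorem norm_circlePoint (θ : ℝ) : ‖circlePoint d θ‖ = 1 := by
  have h : ‖circlePoint d θ‖ ^ 2 = 1 := by
    rw [← real_inner_self_eq_norm_sq, inner_circlePoint, sub_self, Real.cos_zero]
  exact (pow_eq_one_iff_of_nonneg (norm_nonneg _) two_ne_zero).1 h

theorem inner_circlePoint_single_two (θ t : ℝ) :
    inner ℝ (circlePoint (d + 1) θ) (EuclideanSpace.single 2 t) = 0 := by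
  have h2 : 2 % (d + 3) = 2 := Nat.mod_eq_of_lt (by omega)
  have h0 : (2 : Fin (d + 3)) ≠ 0 := by simp [Fin.ext_iff, h2]
  have h1 : (2 : Fin (d + 3)) ≠ 1 := by simp [Fin.ext_iff, h2]
  simp [circlePoint, EuclideanSpace.inner_single_right, h0, h1]

/-- The angles are distinct and lie in `[0, 1)`, so they differ by less than a full turn. -/
theorem cos_div_sub_div_lt_one {m : ℕ} {i j : Fin m} (hij : i ≠ j) :
    Real.cos ((i : ℕ) / m - (j : ℕ) / m) < 1 := by
  have hm : (0 : ℝ) < m := by exact_mod_cast i.pos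
  have h : ∀ i : Fin m, (0 : ℝ) ≤ (i : ℕ) / m ∧ ((i : ℕ) : ℝ) / m < 1 := by
    intro i
    refine ⟨by positivity, ?_⟩
    rw [div_lt_one hm]
    exact_mod_cast i.2
  refine lt_of_le_of_ne (Real.cos_le_one _) fun hc => hij ?_
  rw [Real.cos_eq_one_iff_of_lt_of_lt (by linarith [Real.pi_gt_three, (h i).1, (h j).2])
    (by linarith [Real.pi_gt_three, (h i).2, (h j).1]), sub_eq_zero,
    div_left_inj' hm.ne'] at hc
  exact Fin.ext (by exact_mod_cast hc)

/-- Let `b i` be points on the circle of radius `2` around the origin. If `r` is slightly larger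
than `1`, then for each `i` there is a point with distance `r` from the origin the nearest of the
points `b i'` to which is `b i`, again with distance `r`. -/
theorem exists_pos_forall_exists_dist_circlePoint (m : ℕ) :
    ∃ ε : ℝ, 0 < ε ∧ ∀ r, 1 ≤ r → r ≤ 1 + ε → ∀ i : Fin m,
      ∃ q, ‖q‖ = r ∧ dist ((2 : ℝ) • circlePoint d ((i : ℕ) / m)) q = r ∧
        ∀ i' : Fin m, i' ≠ i → r < dist ((2 : ℝ) • circlePoint d ((i' : ℕ) / m)) q := by
  obtain ⟨η, hη, hη1, hcos⟩ : ∃ η : ℝ, 0 < η ∧ η ≤ 1 ∧ ∀ i j : Fin m, i ≠ j →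
      Real.cos ((i : ℕ) / m - (j : ℕ) / m) + η ≤ 1 := by
    have h : ∀ p : Fin m × Fin m, ∃ η : ℝ, 0 < η ∧ η ≤ 1 ∧
        (p.1 ≠ p.2 → Real.cos ((p.1 : ℕ) / m - (p.2 : ℕ) / m) + η ≤ 1) := by
      rintro ⟨i, j⟩
      by_cases hij : i = j
      · exact ⟨1, one_pos, le_rfl, fun h => absurd hij h⟩
      · have := cos_div_sub_div_lt_one hij
        exact ⟨min 1 (1 - Real.cos ((i : ℕ) / m - (j : ℕ) / m)), lt_min one_pos (by linarith),
          min_le_left _ _, fun _ => by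
            have := min_le_right 1 (1 - Real.cos ((i : ℕ) / m - (j : ℕ) / m))
            dsimp only
            linarith⟩
    choose η hη hη1 hcos using h
    rcases isEmpty_or_nonempty (Fin m) with hE | hE
    · exact ⟨1, one_pos, le_rfl, fun i => hE.elim i⟩
    · obtain ⟨p, hp⟩ := Finite.exists_min η
      exact ⟨η p, hη p, hη1 p, fun i j hij => (by linarith [hp (i, j), hcos (i, j) hij])⟩
  -- This makes `r ^ 2 - 1 ≤ η ^ 2 / 2 + η ^ 4 / 16 < η ^ 2`, so that `h < η` below.
  refine ⟨η ^ 2 / 4, by positivity, fun r hr hrε i => ?_⟩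
  set h := √(r ^ 2 - 1) with hh
  have hr2 : 0 ≤ r ^ 2 - 1 := by nlinarith
  have hsq : h ^ 2 = r ^ 2 - 1 := Real.sq_sqrt hr2
  have hlt : h < η := by
    refine lt_of_pow_lt_pow_left₀ 2 hη.le ?_
    rw [hsq]
    nlinarith [sq_nonneg η, pow_le_one₀ (n := 2) hη.le hη1]
  have hh0 : 0 ≤ h := Real.sqrt_nonneg _
  set θ : ℝ := (i : ℕ) / m
  -- Moving from the midpoint of 0 and `b i` along the tangent direction keeps the two distances
  -- equal; `h` makes both equal to `r`. The other `b i'` stay farther because the gap `η` exceeds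
  -- `h`.
  set q := circlePoint d θ + h • circlePoint d (θ + Real.pi / 2) with hq
  have hinner : ∀ φ, inner ℝ q (circlePoint d φ) =
      Real.cos (θ - φ) + h * Real.cos (θ + Real.pi / 2 - φ) := by
    intro φ
    rw [hq, inner_add_left, inner_smul_left, inner_circlePoint, inner_circlePoint]
    rfl
  have hqr : ‖q‖ ^ 2 = r ^ 2 := by
    rw [hq, norm_add_sq_real, inner_smul_right, inner_circlePoint, norm_smul, norm_circlePoint,
      norm_circlePoint, Real.norm_eq_abs, mul_one, sq_abs, hsq]
    have : θ - (θ + Real.pi / 2) = -(Real.pi / 2) := by ring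
    rw [this, Real.cos_neg, Real.cos_pi_div_two]
    ring
  have hdist : ∀ φ, dist ((2 : ℝ) • circlePoint d φ) q ^ 2 =
      r ^ 2 + 4 * (1 - inner ℝ q (circlePoint d φ)) := by
    intro φ
    rw [dist_comm, dist_eq_norm, norm_sub_sq_real, hqr, inner_smul_right, norm_smul,
      norm_circlePoint, Real.norm_eq_abs, abs_two]
    ring
  have hr0 : 0 ≤ r := by linarith
  refine ⟨q, (pow_left_inj₀ (norm_nonneg _) hr0 two_ne_zero).1 hqr,
    (pow_left_inj₀ dist_nonneg hr0 two_ne_zero).1 ?_, fun i' hi' =>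
    lt_of_pow_lt_pow_left₀ 2 dist_nonneg ?_⟩
  · rw [hdist, hinner, sub_self, add_sub_cancel_left, Real.cos_zero, Real.cos_pi_div_two]
    ring
  · rw [hdist, hinner]
    have h1 := hcos i i' hi'.symm
    have h2 := mul_le_mul_of_nonneg_left (Real.cos_le_one (θ + Real.pi / 2 - (i' : ℕ) / m)) hh0
    linarith

end Circle

/-- In dimension at least three, the Voronoi diagram of points on a circle and on its axis has
quadratically many regions. -/
theorem exists_injective_nearest_point (d m : ℕ) :
    ∃ (f : Fin m ⊕ Fin m → PolygonalCurve (d + 3) 1)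
      (Q : Fin m × Fin m → PolygonalCurve (d + 3) 1),
      Function.Injective fun a => {i | ∀ i', dist (f i) (Q a) ≤ dist (f i') (Q a)} := by
  set u : Fin m → EuclideanSpace ℝ (Fin (d + 3)) := fun i => circlePoint (d + 1) ((i : ℕ) / m)
    with hu
  set z : Fin m → EuclideanSpace ℝ (Fin (d + 3)) := fun j => EuclideanSpace.single 2 ((j : ℕ) : ℝ)
    with hz
  -- Solves `(ρ - 1) ^ 2 + j ^ 2 = ρ ^ 2`: the sphere of radius `ρ j` about `ρ j • u i + z j` is
  -- tangent to the axis at `z j` and passes through `u i`.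
  set ρ : Fin m → ℝ := fun j => (1 + ((j : ℕ) : ℝ) ^ 2) / 2 with hρ
  have hρ0 : ∀ j, 0 < ρ j := fun j => by positivity
  have huz : ∀ i j, inner ℝ (u i) (z j) = 0 := fun i j => inner_circlePoint_single_two _ _
  have hu1 : ∀ i, ‖u i‖ = 1 := fun i => norm_circlePoint _
  have hzn : ∀ j, ‖z j‖ = (j : ℕ) := fun j => by simp [hz]
  have hdu : ∀ i j i', dist (u i') (ρ j • u i + z j) ^ 2 =
      ρ j ^ 2 + 2 * ρ j * (1 - inner ℝ (u i') (u i)) := by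
    intro i j i'
    rw [dist_eq_norm, norm_sub_sq_real, norm_add_sq_real, inner_add_right, inner_smul_left,
      inner_smul_right, huz, huz, norm_smul, hu1, hu1, hzn, Real.norm_of_nonneg (hρ0 j).le]
    simp only [hρ, conj_trivial]
    ring
  have hdz : ∀ i j j', dist (z j') (ρ j • u i + z j) ^ 2 =
      ρ j ^ 2 + (((j' : ℕ) : ℝ) - (j : ℕ)) ^ 2 := by
    intro i j j'
    have h1 : z j' - (ρ j • u i + z j) =
        EuclideanSpace.single 2 (((j' : ℕ) : ℝ) - (j : ℕ)) - ρ j • u i := by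
      simp only [hz]
      rw [show EuclideanSpace.single (2 : Fin (d + 3)) (((j' : ℕ) : ℝ) - (j : ℕ)) =
        EuclideanSpace.single 2 ((j' : ℕ) : ℝ) - EuclideanSpace.single 2 ((j : ℕ) : ℝ) from
        PiLp.single_sub 2 2]
      abel
    rw [dist_eq_norm, h1, norm_sub_sq_real, inner_smul_right, real_inner_comm,
      inner_circlePoint_single_two, norm_smul, hu1,
      PiLp.norm_single, Real.norm_of_nonneg (hρ0 j).le, Real.norm_eq_abs, sq_abs]
    ring
  have hu_lt : ∀ i i', i' ≠ i → inner ℝ (u i') (u i) < 1 := by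
    intro i i' h
    simp only [hu]
    rw [inner_circlePoint]
    exact cos_div_sub_div_lt_one h
  have hu_self : ∀ i, inner ℝ (u i) (u i) = 1 := fun i => by
    rw [real_inner_self_eq_norm_sq, hu1, one_pow]
  have hu_le : ∀ i i', inner ℝ (u i') (u i) ≤ 1 := by
    intro i i'
    rcases eq_or_ne i' i with rfl | h
    · exact (hu_self i').le
    · exact (hu_lt i i' h).le
  refine ⟨fun x _ => Sum.elim u z x,
    fun x _ => ρ x.2 • u x.1 + z x.2, ?_⟩
  simp only [dist_pi_const]
  have hset : ∀ i j, {i₁ | ∀ i₂, dist (Sum.elim u z i₁) (ρ j • u i + z j) ≤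
      dist (Sum.elim u z i₂) (ρ j • u i + z j)} =
      {i₁ | dist (Sum.elim u z i₁) (ρ j • u i + z j) ≤ ρ j} := by
    intro i j
    refine setOf_forall_dist_le_eq (fun i' => le_of_sq_le_sq ?_ dist_nonneg) (Sum.inr j)
      (le_of_sq_le_sq ?_ (hρ0 j).le)
    · rcases i' with i' | j'
      · rw [Sum.elim_inl, hdu]
        have := mul_nonneg (hρ0 j).le (sub_nonneg.2 (hu_le i i'))
        linarith
      · rw [Sum.elim_inr, hdz]
        exact le_add_of_nonneg_right (sq_nonneg _)
    · rw [Sum.elim_inr, hdz]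
      simp
  have hinl : ∀ i j i', dist (Sum.elim u z (Sum.inl i')) (ρ j • u i + z j) ≤ ρ j ↔ i' = i := by
    intro i j i'
    rw [Sum.elim_inl, ← pow_le_pow_iff_left₀ dist_nonneg (hρ0 j).le two_ne_zero, hdu]
    constructor
    · intro h
      by_contra hne
      have := mul_pos (hρ0 j) (sub_pos.2 (hu_lt i i' hne))
      linarith
    · rintro rfl
      rw [hu_self, sub_self, mul_zero, add_zero]
  have hinr : ∀ i j j', dist (Sum.elim u z (Sum.inr j')) (ρ j • u i + z j) ≤ ρ j ↔ j' = j := by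
    intro i j j'
    rw [Sum.elim_inr, ← pow_le_pow_iff_left₀ dist_nonneg (hρ0 j).le two_ne_zero, hdz]
    constructor
    · intro h
      have h1 : (((j' : ℕ) : ℝ) - (j : ℕ)) ^ 2 = 0 := le_antisymm (by linarith) (sq_nonneg _)
      have h2 := sub_eq_zero.1 (pow_eq_zero_iff two_ne_zero |>.1 h1)
      exact Fin.ext (by exact_mod_cast h2)
    · rintro rfl
      simp
  rintro ⟨i, j⟩ ⟨i', j'⟩ h
  simp only [hset] at h
  have h' := Set.ext_iff.1 h
  exact Prod.ext ((hinl i' j' i).1 ((h' _).1 ((hinl i j i).2 rfl)))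
    ((hinr i' j' j).1 ((h' _).1 ((hinr i j j).2 rfl)))

/-! ### Lower bounds in the separate cases -/

/-- Each of the distinct points is its own only nearest site. -/
theorem exists_pow_le_voronoiComplexity_line_point :
    ∃ c : ℝ, 0 < c ∧ ∀ n : ℕ, ∃ S : Finset (PolygonalCurve 1 1),
      S.card = n ∧ c * (n : ℝ) ^ 1 ≤ (voronoiComplexity S : ℝ) := by
  refine exists_pow_le_voronoiComplexity 1 1 one_pos fun m _ =>
    ⟨Fin m, Fin m, inferInstance, inferInstance,
      fun i _ => EuclideanSpace.single 0 ((i : ℕ) : ℝ),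
      fun i _ => EuclideanSpace.single 0 ((i : ℕ) : ℝ), by simp, by simp, fun i j h => ?_⟩
  have h1 := (Set.ext_iff.1 h i).1 fun i' => by rw [dist_self]; exact dist_nonneg
  have h2 := h1 j
  rw [dist_self] at h2
  have h3 := congrFun (dist_le_zero.1 h2) 0
  have h4 := congrArg (fun v : EuclideanSpace ℝ (Fin 1) => v 0) h3
  exact Fin.ext (by simpa using h4)

theorem exists_pow_le_voronoiComplexity_line (k : ℕ) :
    ∃ c : ℝ, 0 < c ∧ ∀ n : ℕ, ∃ S : Finset (PolygonalCurve 1 (k + 2)),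
      S.card = n ∧ c * (n : ℝ) ^ (k + 2) ≤ (voronoiComplexity S : ℝ) := by
  refine exists_pow_le_voronoiComplexity (k + 2) (1 + 6 * (k + 1)) (by omega) fun m hm => ?_
  obtain ⟨f, Q, hQ⟩ := exists_injective_nearest (d := 0) (k := k) hm (fun _ : Unit => 0) one_pos
    fun r hr _ i => ⟨EuclideanSpace.single 0 r, by simp; linarith, by simp; linarith,
      fun i' hi' => absurd rfl hi'⟩
  refine ⟨_, _, inferInstance, inferInstance, f, Q, ?_, ?_, hQ⟩
  · simp only [Fintype.card_sum, Fintype.card_prod, Fintype.card_fin, Fintype.card_units_int,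
      Fintype.card_unit]
    nlinarith
  · simp only [Fintype.card_prod, Fintype.card_fin, Fintype.card_unit, Fintype.card_pi,
      Finset.prod_const, Finset.card_univ]
    exact le_of_eq (by ring)

/-- The exponent counts one factor `m` for the circle point, one for the radius and one for each
coordinate of the `k + 1` later vertices. -/
theorem exists_pow_le_voronoiComplexity_space (d k : ℕ) :
    ∃ c : ℝ, 0 < c ∧ ∀ n : ℕ, ∃ S : Finset (PolygonalCurve (d + 2) (k + 2)),
      S.card = n ∧ c * (n : ℝ) ^ ((d + 2) * (k + 1) + 2) ≤ (voronoiComplexity S : ℝ) := by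
  refine exists_pow_le_voronoiComplexity _ (1 + 6 * ((k + 1) * (d + 2))) (by omega)
    fun m hm => ?_
  obtain ⟨ε, hε, hb⟩ := exists_pos_forall_exists_dist_circlePoint (d := d) m
  obtain ⟨f, Q, hQ⟩ := exists_injective_nearest (d := d + 1) (k := k) hm _ hε hb
  refine ⟨_, _, inferInstance, inferInstance, f, Q, ?_, ?_, hQ⟩
  · simp only [Fintype.card_sum, Fintype.card_prod, Fintype.card_fin, Fintype.card_units_int]
    exact le_of_eq (by ring)
  · simp only [Fintype.card_prod, Fintype.card_fin, Fintype.card_pi,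
      Finset.prod_const, Finset.card_univ]
    exact le_of_eq (by ring)

theorem exists_pow_le_voronoiComplexity_space_point (d : ℕ) :
    ∃ c : ℝ, 0 < c ∧ ∀ n : ℕ, ∃ S : Finset (PolygonalCurve (d + 3) 1),
      S.card = n ∧ c * (n : ℝ) ^ 2 ≤ (voronoiComplexity S : ℝ) := by
  refine exists_pow_le_voronoiComplexity 2 2 two_pos fun m hm => ?_
  obtain ⟨f, Q, hQ⟩ := exists_injective_nearest_point d m
  refine ⟨_, _, inferInstance, inferInstance, f, Q, ?_, ?_, hQ⟩
  · simp only [Fintype.card_sum, Fintype.card_fin]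
    omega
  · simp only [Fintype.card_prod, Fintype.card_fin]
    exact le_of_eq (by ring)

theorem theorem1 (d k : ℕ) (hk : 1 ≤ k) (hdk : d = 2 → 2 ≤ k) :
    (d = 1 ∨ d = 2 →
      ∃ c : ℝ, 0 < c ∧ ∀ n : ℕ, ∃ S : Finset (PolygonalCurve d k),
        S.card = n ∧ c * (n : ℝ) ^ (d * k) ≤ (voronoiComplexity S : ℝ)) ∧
    (2 < d →
      ∃ c : ℝ, 0 < c ∧ ∀ n : ℕ, ∃ S : Finset (PolygonalCurve d k),
        S.card = n ∧ c * (n : ℝ) ^ (d * (k - 1) + 2) ≤ (voronoiComplexity S : ℝ)) := by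
  constructor
  · rintro (rfl | rfl)
    · rw [one_mul]
      obtain rfl | ⟨k, rfl⟩ : k = 1 ∨ ∃ k', k = k' + 2 := by
        rcases hk.eq_or_lt with h | h
        · exact Or.inl h.symm
        · exact Or.inr (Nat.exists_eq_add_of_le' h)
      · exact exists_pow_le_voronoiComplexity_line_point
      · exact exists_pow_le_voronoiComplexity_line k
    · obtain ⟨k, rfl⟩ := Nat.exists_eq_add_of_le' (hdk rfl)
      -- In the plane the exponents agree: `2 * (k + 1) + 2 = 2 * (k + 2)`.
      exact exists_pow_le_voronoiComplexity_space 0 k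
  · intro hd
    obtain ⟨d, rfl⟩ := Nat.exists_eq_add_of_le' hd
    obtain rfl | ⟨k, rfl⟩ : k = 1 ∨ ∃ k', k = k' + 2 := by
      rcases hk.eq_or_lt with h | h
      · exact Or.inl h.symm
      · exact Or.inr (Nat.exists_eq_add_of_le' h)
    · exact exists_pow_le_voronoiComplexity_space_point d
    · exact exists_pow_le_voronoiComplexity_space (d + 1) k
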